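/- Let $E$ be a real Banach space with dual $E^*$. For $f\colon E^*\to\mathbb R$ put $$\|f\|_{FBL[E]}=\sup\Big\{\sum_{i=1}^n|f(x_i^*)| : n\in\mathbb N,\ x_1^*,\dots,x_n^*\in E^*,\ \sup_{\|x\|\le 1}\sum_{i=1}^n|x_i^*(x)|\le 1\Big\}\in[0,\infty].$$ The positively homogeneous functions $f$ with $\|f\|_{FBL[E]}<\infty$ form a Banach lattice under this norm and the pointwise order; the free Banach lattice $FBL[E]$ is the norm closure in it of the vector lattice generated by the evaluations $\delta_x\colon x^*\mapsto x^*(x)$, $x\in E$. A Banach lattice $P$ is $\lambda$-projective, for a real number $\lambda>1$, if for every Banach lattice $X$, every closed ideal $J$ of $X$ with quotient map $Q\colon X\to X/J$, and every Banach lattice homomorphism $T\colon P\to X/J$ there is a Banach lattice homomorphism $\hat T\colon P\to X$ with $T=Q\circ\hat T$ and $\|\hat T\|\le\lambda\|T\|$. It is $\infty$-projective if it is $\lambda$-projective for some $\lambda>1$. **Theorem.** If $FBL[E]$ is $\infty$-projective, then $E$ has the Schur property: every weakly convergent sequence in $E$ converges in norm. -/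

import Mathlib

open Filter Topology
open scoped ENNReal

/-! A (real) Banach lattice is a real Banach space `X` with a lattice order making it a vector
lattice with a solid norm. It is given by the Mathlib classes
`[NormedAddCommGroup X] [NormedSpace ℝ X] [CompleteSpace X] [Lattice X] [IsOrderedAddMonoid X]
[IsOrderedModule ℝ X] [HasSolidNorm X]`. -/

namespace BLat

section Homomorphisms

/-- A bounded operator between Banach lattices is a Banach lattice homomorphism if it preserves
finite suprema and infima. -/
def IsLatticeHom {X Y : Type*} [NormedAddCommGroup X] [NormedSpace ℝ X] [Lattice X]
    [NormedAddCommGroup Y] [NormedSpace ℝ Y] [Lattice Y] (T : X →L[ℝ] Y) : Prop :=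
  (∀ x y, T (x ⊔ y) = T x ⊔ T y) ∧ (∀ x y, T (x ⊓ y) = T x ⊓ T y)

end Homomorphisms

section Quotients

theorem abs_sup_sub_sup_le {X : Type*} [AddCommGroup X] [Lattice X] [IsOrderedAddMonoid X]
    (a b c d : X) : |a ⊔ c - b ⊔ d| ≤ |a - b| + |c - d| := by
  have h1 := abs_sup_sub_sup_le_abs a b c
  have h2 := abs_sup_sub_sup_le_abs c d b
  rw [sup_comm c b, sup_comm d b] at h2
  calc |a ⊔ c - b ⊔ d| = |(a ⊔ c - b ⊔ c) + (b ⊔ c - b ⊔ d)| := by rw [sub_add_sub_cancel]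
    _ ≤ |a ⊔ c - b ⊔ c| + |b ⊔ c - b ⊔ d| := abs_add_le _ _
    _ ≤ _ := add_le_add h1 h2

theorem abs_inf_sub_inf_le {X : Type*} [AddCommGroup X] [Lattice X] [IsOrderedAddMonoid X]
    (a b c d : X) : |a ⊓ c - b ⊓ d| ≤ |a - b| + |c - d| := by
  have h1 := abs_inf_sub_inf_le_abs a b c
  have h2 := abs_inf_sub_inf_le_abs c d b
  rw [inf_comm c b, inf_comm d b] at h2
  calc |a ⊓ c - b ⊓ d| = |(a ⊓ c - b ⊓ c) + (b ⊓ c - b ⊓ d)| := by rw [sub_add_sub_cancel]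
    _ ≤ |a ⊓ c - b ⊓ c| + |b ⊓ c - b ⊓ d| := abs_add_le _ _
    _ ≤ _ := add_le_add h1 h2

/-- A closed (order) ideal of a normed lattice: a norm closed, solid linear subspace. -/
structure ClosedIdeal (X : Type*) [NormedAddCommGroup X] [NormedSpace ℝ X] [Lattice X] extends
    Submodule ℝ X where
  solid' : LatticeOrderedAddCommGroup.IsSolid carrier
  closed' : IsClosed carrier

variable {X : Type*} [NormedAddCommGroup X] [NormedSpace ℝ X] [Lattice X]

instance (J : ClosedIdeal X) : IsClosed (J.toSubmodule : Set X) := J.closed'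

theorem ClosedIdeal.mem_of_abs_le (J : ClosedIdeal X) {x y : X} (hx : x ∈ J.toSubmodule)
    (h : |y| ≤ |x|) : y ∈ J.toSubmodule :=
  J.solid' hx h

variable [IsOrderedAddMonoid X]

theorem ClosedIdeal.abs_mem (J : ClosedIdeal X) {x : X} (hx : x ∈ J.toSubmodule) :
    |x| ∈ J.toSubmodule :=
  J.mem_of_abs_le hx (abs_abs x).le

theorem ClosedIdeal.sub_mem_of_le (J : ClosedIdeal X) {a b c d z : X}
    (hab : a - b ∈ J.toSubmodule) (hcd : c - d ∈ J.toSubmodule)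
    (h : |z| ≤ |a - b| + |c - d|) : z ∈ J.toSubmodule :=
  J.mem_of_abs_le (J.toSubmodule.add_mem (J.abs_mem hab) (J.abs_mem hcd))
    (h.trans (le_abs_self _))

/-- The quotient `X ⧸ J` is a lattice, with `[a] ⊔ [b] = [a ⊔ b]` and `[a] ⊓ [b] = [a ⊓ b]`
(so that the quotient map is a lattice homomorphism). Its norm is the quotient norm of Mathlib. -/
instance quotientLattice (J : ClosedIdeal X) : Lattice (X ⧸ J.toSubmodule) :=
  letI : Max (X ⧸ J.toSubmodule) := ⟨Quotient.map₂ (· ⊔ ·) (by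
    intro a b hab c d hcd
    exact (Submodule.quotientRel_def _).2 <| J.sub_mem_of_le ((Submodule.quotientRel_def _).1 hab)
      ((Submodule.quotientRel_def _).1 hcd) (abs_sup_sub_sup_le a b c d))⟩
  letI : Min (X ⧸ J.toSubmodule) := ⟨Quotient.map₂ (· ⊓ ·) (by
    intro a b hab c d hcd
    exact (Submodule.quotientRel_def _).2 <| J.sub_mem_of_le ((Submodule.quotientRel_def _).1 hab)
      ((Submodule.quotientRel_def _).1 hcd) (abs_inf_sub_inf_le a b c d))⟩
  Lattice.mk'
    (by rintro ⟨a⟩ ⟨b⟩; exact congrArg J.toSubmodule.mkQ (sup_comm a b))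
    (by rintro ⟨a⟩ ⟨b⟩ ⟨c⟩; exact congrArg J.toSubmodule.mkQ (sup_assoc a b c))
    (by rintro ⟨a⟩ ⟨b⟩; exact congrArg J.toSubmodule.mkQ (inf_comm a b))
    (by rintro ⟨a⟩ ⟨b⟩ ⟨c⟩; exact congrArg J.toSubmodule.mkQ (inf_assoc a b c))
    (by rintro ⟨a⟩ ⟨b⟩; exact congrArg J.toSubmodule.mkQ (sup_inf_self (a := a) (b := b)))
    (by rintro ⟨a⟩ ⟨b⟩; exact congrArg J.toSubmodule.mkQ (inf_sup_self (a := a) (b := b)))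

theorem mkQ_sup (J : ClosedIdeal X) (a b : X) :
    J.toSubmodule.mkQ (a ⊔ b) = J.toSubmodule.mkQ a ⊔ J.toSubmodule.mkQ b := rfl

theorem mkQ_inf (J : ClosedIdeal X) (a b : X) :
    J.toSubmodule.mkQ (a ⊓ b) = J.toSubmodule.mkQ a ⊓ J.toSubmodule.mkQ b := rfl

/-- The order of `X ⧸ J` is the image of the order of `X`. -/
theorem mkQ_le_mkQ_iff (J : ClosedIdeal X) (a b : X) :
    J.toSubmodule.mkQ a ≤ J.toSubmodule.mkQ b ↔ ∃ j ∈ J.toSubmodule, a ≤ b + j := by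
  constructor
  · intro h
    rw [← sup_eq_right, ← mkQ_sup] at h
    have h' : a ⊔ b - b ∈ J.toSubmodule := (Submodule.Quotient.eq _).1 h
    exact ⟨_, h', by simp⟩
  · rintro ⟨j, hj, h⟩
    have h1 : J.toSubmodule.mkQ (b + j) = J.toSubmodule.mkQ b := by
      rw [map_add, (Submodule.Quotient.mk_eq_zero J.toSubmodule (x := j)).2 hj |> fun e =>
        (show J.toSubmodule.mkQ j = 0 from e), add_zero]
    rw [← h1, ← sup_eq_right, ← mkQ_sup, sup_eq_right.2 h]

theorem mkQ_mono (J : ClosedIdeal X) {a b : X} (h : a ≤ b) :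
    J.toSubmodule.mkQ a ≤ J.toSubmodule.mkQ b :=
  (mkQ_le_mkQ_iff J a b).2 ⟨0, zero_mem _, by simpa using h⟩

theorem exists_rep_le (J : ClosedIdeal X) {p q : X ⧸ J.toSubmodule} (h : p ≤ q) :
    ∃ a b, J.toSubmodule.mkQ a = p ∧ J.toSubmodule.mkQ b = q ∧ a ≤ b := by
  obtain ⟨a, rfl⟩ := J.toSubmodule.mkQ_surjective p
  obtain ⟨b, rfl⟩ := J.toSubmodule.mkQ_surjective q
  exact ⟨a, a ⊔ b, rfl, by rw [mkQ_sup, sup_eq_right.2 h], le_sup_left⟩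

instance (J : ClosedIdeal X) : IsOrderedAddMonoid (X ⧸ J.toSubmodule) where
  add_le_add_left p q h r := by
    obtain ⟨a, b, rfl, rfl, hab⟩ := exists_rep_le J h
    obtain ⟨c, rfl⟩ := J.toSubmodule.mkQ_surjective r
    rw [← map_add, ← map_add]
    exact mkQ_mono J (by gcongr)

instance [IsOrderedModule ℝ X] (J : ClosedIdeal X) :
    IsOrderedModule ℝ (X ⧸ J.toSubmodule) where
  smul_le_smul_of_nonneg_left r hr p q h := by
    obtain ⟨a, b, rfl, rfl, hab⟩ := exists_rep_le J h
    change r • J.toSubmodule.mkQ a ≤ r • J.toSubmodule.mkQ b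
    rw [← map_smul, ← map_smul]
    exact mkQ_mono J (smul_le_smul_of_nonneg_left hab hr)
  smul_le_smul_of_nonneg_right p hp r s hrs := by
    obtain ⟨a, b, ha, rfl, hab⟩ := exists_rep_le J hp
    have h0 : (0 : X ⧸ J.toSubmodule) = J.toSubmodule.mkQ 0 := (map_zero _).symm
    have hb : J.toSubmodule.mkQ (0 ⊔ b) = J.toSubmodule.mkQ b := by
      rw [mkQ_sup, ← h0]; exact sup_eq_right.2 hp
    change r • J.toSubmodule.mkQ b ≤ s • J.toSubmodule.mkQ b
    rw [← hb, ← map_smul, ← map_smul]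
    exact mkQ_mono J (smul_le_smul_of_nonneg_right hrs le_sup_left)

instance [HasSolidNorm X] (J : ClosedIdeal X) : HasSolidNorm (X ⧸ J.toSubmodule) where
  solid p q h := by
    refine le_of_forall_pos_le_add fun ε hε => ?_
    obtain ⟨b, rfl, hb⟩ := Submodule.Quotient.norm_mk_lt (S := J.toSubmodule) q hε
    obtain ⟨a, rfl⟩ := J.toSubmodule.mkQ_surjective p
    set π := J.toSubmodule.mkQ
    have habs : π |b| = |π b| := by
      change π (b ⊔ -b) = π b ⊔ -π b
      rw [mkQ_sup, map_neg]
    have h' : |π a| ≤ |π b| := h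
    have e : π ((a ⊓ |b|) ⊔ -|b|) = π a := by
      rw [mkQ_sup, mkQ_inf, map_neg, habs, inf_eq_left.2 ((le_abs_self _).trans h'),
        sup_eq_left.2 (neg_le.1 ((neg_le_abs _).trans h'))]
    have hle : abs ((a ⊓ |b|) ⊔ -|b|) ≤ |b| := by
      refine abs_le'.2 ⟨sup_le inf_le_right ?_, ?_⟩
      · exact (neg_nonpos.2 (abs_nonneg b)).trans (abs_nonneg b)
      · exact neg_le.1 le_sup_right
    calc ‖π a‖ = ‖π ((a ⊓ |b|) ⊔ -|b|)‖ := by rw [e]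
      _ ≤ ‖(a ⊓ |b|) ⊔ -|b|‖ := Submodule.Quotient.norm_mk_le _ _
      _ ≤ ‖b‖ := norm_le_norm_of_abs_le_abs hle
      _ ≤ _ := hb.le

end Quotients

section Projectivity

universe u

/-- `P` is `lam`-projective: every Banach lattice homomorphism `T` from `P` to a quotient `X ⧸ J`
of a Banach lattice by a closed ideal lifts to a Banach lattice homomorphism `That : P → X` with
`‖That‖ ≤ lam * ‖T‖`. -/
def IsProjectiveWith (lam : ℝ) (P : Type u) [NormedAddCommGroup P] [NormedSpace ℝ P]
    [CompleteSpace P] [Lattice P] [IsOrderedAddMonoid P] [IsOrderedModule ℝ P]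
    [HasSolidNorm P] : Prop :=
  ∀ (X : Type u) [NormedAddCommGroup X] [NormedSpace ℝ X] [CompleteSpace X] [Lattice X]
    [IsOrderedAddMonoid X] [IsOrderedModule ℝ X] [HasSolidNorm X] (J : ClosedIdeal X)
    (T : P →L[ℝ] X ⧸ J.toSubmodule), IsLatticeHom T →
    ∃ That : P →L[ℝ] X, IsLatticeHom That ∧
      (∀ p, T p = J.toSubmodule.mkQ (That p)) ∧ ‖That‖ ≤ lam * ‖T‖

/-- `P` is `∞`-projective if it is `lam`-projective for some real `lam > 1`. -/
def IsInftyProjective (P : Type u) [NormedAddCommGroup P] [NormedSpace ℝ P]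
    [CompleteSpace P] [Lattice P] [IsOrderedAddMonoid P] [IsOrderedModule ℝ P]
    [HasSolidNorm P] : Prop :=
  ∃ lam : ℝ, 1 < lam ∧ IsProjectiveWith lam P

end Projectivity

section Sublattices

/-- A vector sublattice: a linear subspace closed under finite suprema and infima. -/
structure VectorSublattice (X : Type*) [AddCommGroup X] [Module ℝ X] [Lattice X] extends
    Submodule ℝ X where
  sup_mem' : ∀ x ∈ carrier, ∀ y ∈ carrier, x ⊔ y ∈ carrier
  inf_mem' : ∀ x ∈ carrier, ∀ y ∈ carrier, x ⊓ y ∈ carrier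

/-- A vector sublattice is a lattice under the restricted operations. -/
instance sublatticeLattice {X : Type*} [AddCommGroup X] [Module ℝ X] [Lattice X]
    (S : VectorSublattice X) : Lattice S.toSubmodule :=
  Subtype.lattice (fun {x y} hx hy => S.sup_mem' x hx y hy)
    (fun {x y} hx hy => S.inf_mem' x hx y hy)

instance {X : Type*} [AddCommGroup X] [Module ℝ X] [Lattice X] [IsOrderedAddMonoid X]
    (S : VectorSublattice X) : IsOrderedAddMonoid S.toSubmodule where
  add_le_add_left a b h c := add_le_add_left (show (a : X) ≤ b from h) (c : X)

instance {X : Type*} [AddCommGroup X] [Module ℝ X] [Lattice X] [IsOrderedModule ℝ X]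
    (S : VectorSublattice X) : IsOrderedModule ℝ S.toSubmodule where
  smul_le_smul_of_nonneg_left r hr a b h :=
    show r • (a : X) ≤ r • (b : X) from smul_le_smul_of_nonneg_left (show (a : X) ≤ b from h) hr
  smul_le_smul_of_nonneg_right a ha r s h :=
    show r • (a : X) ≤ s • (a : X) from
      smul_le_smul_of_nonneg_right h (show (0 : X) ≤ a from ha)

instance {X : Type*} [NormedAddCommGroup X] [NormedSpace ℝ X] [Lattice X] [HasSolidNorm X]
    (S : VectorSublattice X) : HasSolidNorm S.toSubmodule where
  solid a b h := HasSolidNorm.solid (α := X) (show |(a : X)| ≤ |(b : X)| from h)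

/-- The vector sublattice generated by a set: the intersection of all vector sublattices
containing it. -/
def VectorSublattice.generate {X : Type*} [AddCommGroup X] [Module ℝ X] [Lattice X]
    (A : Set X) : VectorSublattice X where
  carrier := {x | ∀ S : VectorSublattice X, A ⊆ S.carrier → x ∈ S.carrier}
  zero_mem' S _ := S.zero_mem'
  add_mem' hx hy S h := S.add_mem' (hx S h) (hy S h)
  smul_mem' c _ hx S h := S.smul_mem' c (hx S h)
  sup_mem' _ hx _ hy S h := S.sup_mem' _ (hx S h) _ (hy S h)
  inf_mem' _ hx _ hy S h := S.inf_mem' _ (hx S h) _ (hy S h)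

/-- The norm closure of a vector sublattice of a normed lattice. -/
def VectorSublattice.normClosure {X : Type*} [NormedAddCommGroup X] [NormedSpace ℝ X] [Lattice X]
    [IsOrderedAddMonoid X] [HasSolidNorm X] (S : VectorSublattice X) : VectorSublattice X where
  toSubmodule := S.toSubmodule.topologicalClosure
  sup_mem' _ hx _ hy := map_mem_closure₂ continuous_sup hx hy S.sup_mem'
  inf_mem' _ hx _ hy := map_mem_closure₂ continuous_inf hx hy S.inf_mem'

end Sublattices

section FreeBanachLattice

variable (E : Type*) [NormedAddCommGroup E] [NormedSpace ℝ E]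

/-- The finite families `x₁*, …, xₙ*` in `E*` with `∑ |xᵢ*(x)| ≤ 1` for all `x` in the closed
unit ball of `E`. -/
def AdmissibleFamily : Type _ :=
  {p : Σ n : ℕ, (Fin n → StrongDual ℝ E) // ∀ x : E, ‖x‖ ≤ 1 → ∑ i, |p.2 i x| ≤ 1}

variable {E}

/-- The (possibly infinite) quantity `‖f‖_{FBL[E]} = sup ∑ |f (xᵢ*)|`, the supremum running over
all admissible families. -/
noncomputable def fblNorm (f : StrongDual ℝ E → ℝ) : ℝ≥0∞ :=
  ⨆ p : AdmissibleFamily E, ∑ i, ‖f (p.1.2 i)‖ₑ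

theorem fblNorm_mono {f g : StrongDual ℝ E → ℝ} (h : ∀ φ, |f φ| ≤ |g φ|) :
    fblNorm f ≤ fblNorm g :=
  iSup_mono fun _ => Finset.sum_le_sum fun _ _ => enorm_le_iff_norm_le.2 (h _)

theorem fblNorm_add_le (f g : StrongDual ℝ E → ℝ) :
    fblNorm (f + g) ≤ fblNorm f + fblNorm g := by
  refine iSup_le fun p => ?_
  calc ∑ i, ‖(f + g) (p.1.2 i)‖ₑ ≤ ∑ i, (‖f (p.1.2 i)‖ₑ + ‖g (p.1.2 i)‖ₑ) :=
        Finset.sum_le_sum fun i _ => enorm_add_le _ _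
    _ = ∑ i, ‖f (p.1.2 i)‖ₑ + ∑ i, ‖g (p.1.2 i)‖ₑ := Finset.sum_add_distrib
    _ ≤ _ := add_le_add (le_iSup (fun p : AdmissibleFamily E => ∑ i, ‖f (p.1.2 i)‖ₑ) p)
        (le_iSup (fun p : AdmissibleFamily E => ∑ i, ‖g (p.1.2 i)‖ₑ) p)

theorem fblNorm_smul (c : ℝ) (f : StrongDual ℝ E → ℝ) :
    fblNorm (c • f) = ‖c‖ₑ * fblNorm f := by
  simp only [fblNorm, Pi.smul_apply, enorm_smul, ← Finset.mul_sum, ENNReal.mul_iSup]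

theorem fblNorm_zero : fblNorm (0 : StrongDual ℝ E → ℝ) = 0 := by
  simp [fblNorm]

theorem fblNorm_abs_add_abs_lt_top {f g : StrongDual ℝ E → ℝ} (hf : fblNorm f < ⊤)
    (hg : fblNorm g < ⊤) : fblNorm (fun φ => |f φ| + |g φ|) < ⊤ := by
  refine (fblNorm_add_le (fun φ => |f φ|) (fun φ => |g φ|)).trans_lt (ENNReal.add_lt_top.2 ⟨?_, ?_⟩)
  · exact (fblNorm_mono (fun φ => (abs_abs (f φ)).le)).trans_lt hf
  · exact (fblNorm_mono (fun φ => (abs_abs (g φ)).le)).trans_lt hg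

/-- A single functional of norm at most one is an admissible family. -/
def AdmissibleFamily.single (φ : StrongDual ℝ E) (h : ‖φ‖ ≤ 1) : AdmissibleFamily E :=
  ⟨⟨1, fun _ => φ⟩, fun x hx => by
    simpa using (φ.le_opNorm x).trans (mul_le_one₀ h (norm_nonneg _) hx)⟩

theorem enorm_apply_le_fblNorm (f : StrongDual ℝ E → ℝ) {φ : StrongDual ℝ E} (h : ‖φ‖ ≤ 1) :
    ‖f φ‖ₑ ≤ fblNorm f := by
  refine le_trans ?_ (le_iSup (fun p : AdmissibleFamily E => ∑ i, ‖f (p.1.2 i)‖ₑ)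
    (AdmissibleFamily.single φ h))
  change ‖f φ‖ₑ ≤ ∑ _i : Fin 1, ‖f φ‖ₑ
  simp

variable (E)

/-- The vector lattice of all positively homogeneous functions `f : E* → ℝ` with
`‖f‖_{FBL[E]} < ∞`, with pointwise operations and order. -/
def homFunSublattice : VectorSublattice (StrongDual ℝ E → ℝ) where
  carrier := {f | (∀ c : ℝ, 0 ≤ c → ∀ φ, f (c • φ) = c * f φ) ∧ fblNorm f < ⊤}
  zero_mem' := ⟨by simp, by simp [fblNorm_zero]⟩
  add_mem' {f g} hf hg := ⟨fun c hc φ => by simp [hf.1 c hc, hg.1 c hc, mul_add],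
    (fblNorm_add_le f g).trans_lt (ENNReal.add_lt_top.2 ⟨hf.2, hg.2⟩)⟩
  smul_mem' r f hf := ⟨fun c hc φ => by simp [hf.1 c hc, mul_left_comm], by
    rw [fblNorm_smul]; exact ENNReal.mul_lt_top enorm_lt_top hf.2⟩
  sup_mem' f hf g hg := ⟨fun c hc φ => by
      simp only [Pi.sup_apply, hf.1 c hc, hg.1 c hc]; exact (mul_max_of_nonneg _ _ hc).symm, by
    refine (fblNorm_mono fun φ => ?_).trans_lt (fblNorm_abs_add_abs_lt_top hf.2 hg.2)
    refine (abs_max_le_max_abs_abs).trans ((max_le_add_of_nonneg (abs_nonneg _)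
      (abs_nonneg _)).trans (le_abs_self _))⟩
  inf_mem' f hf g hg := ⟨fun c hc φ => by
      simp only [Pi.inf_apply, hf.1 c hc, hg.1 c hc]; exact (mul_min_of_nonneg _ _ hc).symm, by
    refine (fblNorm_mono fun φ => ?_).trans_lt (fblNorm_abs_add_abs_lt_top hf.2 hg.2)
    refine (abs_min_le_max_abs_abs).trans ((max_le_add_of_nonneg (abs_nonneg _)
      (abs_nonneg _)).trans (le_abs_self _))⟩

/-- The Banach lattice of all positively homogeneous functions `f : E* → ℝ` with
`‖f‖_{FBL[E]} < ∞`, normed by `‖·‖_{FBL[E]}`. -/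
def HomFun : Type _ := (homFunSublattice E).toSubmodule

namespace HomFun

instance : AddCommGroup (HomFun E) := inferInstanceAs (AddCommGroup (homFunSublattice E).toSubmodule)

instance : Module ℝ (HomFun E) := inferInstanceAs (Module ℝ (homFunSublattice E).toSubmodule)

instance : Lattice (HomFun E) := inferInstanceAs (Lattice (homFunSublattice E).toSubmodule)

instance : IsOrderedAddMonoid (HomFun E) :=
  inferInstanceAs (IsOrderedAddMonoid (homFunSublattice E).toSubmodule)

instance : IsOrderedModule ℝ (HomFun E) :=
  letI : IsOrderedModule ℝ (StrongDual ℝ E → ℝ) :=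
    { smul_le_smul_of_nonneg_left := fun _ hr _ _ h φ => mul_le_mul_of_nonneg_left (h φ) hr
      smul_le_smul_of_nonneg_right := fun _ hf _ _ h φ => mul_le_mul_of_nonneg_right h (hf φ) }
  inferInstanceAs (IsOrderedModule ℝ (homFunSublattice E).toSubmodule)

variable {E}

theorem fblNorm_ne_top (f : HomFun E) : fblNorm f.1 ≠ ⊤ := f.2.2.ne

theorem apply_eq_norm_mul (f : HomFun E) (φ : StrongDual ℝ E) :
    f.1 φ = ‖φ‖ * f.1 (‖φ‖⁻¹ • φ) := by
  rw [← f.2.1 _ (norm_nonneg φ), smul_smul]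
  rcases eq_or_ne φ 0 with rfl | h
  · simp
  · rw [mul_inv_cancel₀ (norm_ne_zero_iff.2 h), one_smul]

theorem abs_apply_le (f : HomFun E) (φ : StrongDual ℝ E) :
    |f.1 φ| ≤ ‖φ‖ * (fblNorm f.1).toReal := by
  rw [apply_eq_norm_mul, abs_mul, abs_of_nonneg (norm_nonneg φ)]
  refine mul_le_mul_of_nonneg_left ?_ (norm_nonneg φ)
  have h1 : ‖‖φ‖⁻¹ • φ‖ ≤ 1 := by
    rw [norm_smul, norm_inv, norm_norm]; exact inv_mul_le_one
  have := ENNReal.toReal_mono f.fblNorm_ne_top (enorm_apply_le_fblNorm f.1 h1)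
  simpa using this

variable (E)

noncomputable instance : NormedAddCommGroup (HomFun E) :=
  AddGroupNorm.toNormedAddCommGroup
    { toFun := fun f => (fblNorm f.1).toReal
      map_zero' := by
        change (fblNorm (0 : StrongDual ℝ E → ℝ)).toReal = 0
        simp [fblNorm_zero]
      add_le' := fun f g => by
        rw [← ENNReal.toReal_add f.fblNorm_ne_top g.fblNorm_ne_top]
        exact ENNReal.toReal_mono (ENNReal.add_ne_top.2 ⟨f.fblNorm_ne_top, g.fblNorm_ne_top⟩)
          (fblNorm_add_le f.1 g.1)
      neg' := fun f => by
        congr 1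
        exact le_antisymm (fblNorm_mono fun φ => (abs_neg (f.1 φ)).le)
          (fblNorm_mono fun φ => (abs_neg (f.1 φ)).ge)
      eq_zero_of_map_eq_zero' := fun f hf => by
        refine Subtype.ext (funext fun φ => ?_)
        have := f.abs_apply_le φ
        have hf' : (fblNorm f.1).toReal = 0 := hf
        rw [hf', mul_zero] at this
        exact abs_nonpos_iff.1 this }

variable {E}

theorem norm_def (f : HomFun E) : ‖f‖ = (fblNorm f.1).toReal := rfl

variable (E)

noncomputable instance : NormedSpace ℝ (HomFun E) where
  norm_smul_le c f := by
    rw [norm_def, norm_def]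
    change (fblNorm (c • f.1)).toReal ≤ _
    rw [fblNorm_smul, ENNReal.toReal_mul, toReal_enorm]

instance : HasSolidNorm (HomFun E) where
  solid _ g h := ENNReal.toReal_mono g.fblNorm_ne_top (fblNorm_mono h)

variable {E}

theorem enorm_eq (f : HomFun E) : ‖f‖ₑ = fblNorm f.1 := by
  rw [← ofReal_norm, norm_def, ENNReal.ofReal_toReal f.fblNorm_ne_top]

theorem sub_apply (f g : HomFun E) (φ : StrongDual ℝ E) : (f - g).1 φ = f.1 φ - g.1 φ := rfl

variable (E)

instance : CompleteSpace (HomFun E) := by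
  refine Metric.complete_of_cauchySeq_tendsto fun u hu => ?_
  have hc : ∀ φ, CauchySeq fun n => (u n).1 φ := by
    intro φ
    rw [Metric.cauchySeq_iff'] at hu ⊢
    intro ε hε
    obtain ⟨N, hN⟩ := hu (ε / (‖φ‖ + 1)) (by positivity)
    refine ⟨N, fun n hn => ?_⟩
    have h1 := abs_apply_le (u n - u N) φ
    have h2 := hN n hn
    rw [dist_eq_norm, lt_div_iff₀ (by positivity), norm_def] at h2
    rw [Real.dist_eq, ← sub_apply]
    nlinarith [ENNReal.toReal_nonneg (a := fblNorm (u n - u N).1), norm_nonneg φ]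
  choose F hF using fun φ => cauchySeq_tendsto_of_complete (hc φ)
  have key : ∀ ε : ℝ≥0∞, 0 < ε → ∃ N, ∀ n ≥ N, fblNorm (fun φ => (u n).1 φ - F φ) ≤ ε := by
    intro ε hε
    obtain ⟨N, hN⟩ := EMetric.cauchySeq_iff.1 hu ε hε
    refine ⟨N, fun n hn => iSup_le fun p => ?_⟩
    have hlim : Tendsto (fun m => ∑ i, ‖(u n).1 (p.1.2 i) - (u m).1 (p.1.2 i)‖ₑ) atTop
        (𝓝 (∑ i, ‖(u n).1 (p.1.2 i) - F (p.1.2 i)‖ₑ)) :=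
      tendsto_finsetSum _ fun i _ => (tendsto_const_nhds.sub (hF _)).enorm
    refine le_of_tendsto hlim (eventually_atTop.2 ⟨N, fun m hm => ?_⟩)
    have h1 := (hN n hn m hm).le
    rw [edist_eq_enorm_sub, enorm_eq] at h1
    exact (le_iSup (fun p : AdmissibleFamily E => ∑ i, ‖(u n - u m).1 (p.1.2 i)‖ₑ) p).trans h1
  have hmem : F ∈ (homFunSublattice E).toSubmodule := by
    refine ⟨fun c hc φ => ?_, ?_⟩
    · refine tendsto_nhds_unique (hF (c • φ)) ?_
      simp only [(u _).2.1 c hc]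
      exact (hF φ).const_mul c
    · obtain ⟨N, hN⟩ := key 1 one_pos
      have e : F = (u N).1 + (-1 : ℝ) • fun φ => (u N).1 φ - F φ := by
        ext φ; simp
      rw [e]
      refine (fblNorm_add_le _ _).trans_lt (ENNReal.add_lt_top.2 ⟨(u N).2.2, ?_⟩)
      rw [fblNorm_smul]
      exact ENNReal.mul_lt_top enorm_lt_top ((hN N le_rfl).trans_lt ENNReal.one_lt_top)
  let f : HomFun E := ⟨F, hmem⟩
  refine ⟨f, EMetric.tendsto_atTop.2 fun ε hε => ?_⟩
  obtain ⟨δ, hδ, hδε⟩ := exists_between hε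
  obtain ⟨N, hN⟩ := key δ hδ
  refine ⟨N, fun n hn => ?_⟩
  rw [edist_eq_enorm_sub, enorm_eq]
  exact (hN n hn).trans_lt hδε

end HomFun

variable {E}

/-- The evaluation `δ_x : x* ↦ x*(x)`; one has `‖δ_x‖_{FBL[E]} ≤ ‖x‖ < ∞`. -/
def evalAt (x : E) : HomFun E :=
  ⟨fun φ => φ x, fun c _ φ => by simp, by
    refine lt_of_le_of_lt (iSup_le fun p => ?_) (ENNReal.ofReal_lt_top (r := ‖x‖))
    have h : ∑ i, |p.1.2 i x| ≤ ‖x‖ := by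
      rcases eq_or_ne x 0 with rfl | hx
      · simp
      · have h0 : 0 < ‖x‖ := norm_pos_iff.2 hx
        have h1 := p.2 (‖x‖⁻¹ • x) (by rw [norm_smul]; simp [h0.ne'])
        simp only [map_smul, smul_eq_mul, abs_mul, abs_inv, abs_norm, ← Finset.mul_sum] at h1
        rwa [inv_mul_le_iff₀ h0, mul_one] at h1
    calc ∑ i, ‖p.1.2 i x‖ₑ = ENNReal.ofReal (∑ i, |p.1.2 i x|) := by
          rw [ENNReal.ofReal_sum_of_nonneg fun _ _ => abs_nonneg _]
          exact Finset.sum_congr rfl fun i _ => Real.enorm_eq_ofReal_abs _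
      _ ≤ _ := ENNReal.ofReal_le_ofReal h⟩

variable (E)

/-- The closed vector sublattice of `HomFun E` generated by the evaluations `δ_x`, `x ∈ E`. -/
noncomputable def fblSublattice : VectorSublattice (HomFun E) :=
  (VectorSublattice.generate (Set.range (evalAt (E := E)))).normClosure

/-- The free Banach lattice `FBL[E]` generated by the Banach space `E`: the norm closure of the
vector lattice generated by the evaluations `δ_x`, `x ∈ E`, with the norm `‖·‖_{FBL[E]}` and the
pointwise order. -/
abbrev FBL : Type _ := (fblSublattice E).toSubmodule

instance : CompleteSpace (FBL E) :=
  (Submodule.isClosed_topologicalClosure _).completeSpace_coe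

end FreeBanachLattice

section Schur

/-- The Schur property: every weakly convergent sequence converges in norm (to its weak limit). -/
def SchurProperty (E : Type*) [NormedAddCommGroup E] [NormedSpace ℝ E] : Prop :=
  ∀ (u : ℕ → E) (x : E),
    Tendsto (fun n => toWeakSpace ℝ E (u n)) atTop (𝓝 (toWeakSpace ℝ E x)) →
      Tendsto u atTop (𝓝 x)

end Schur

end BLat

/-! Projectivity is tested on a single Banach lattice of functions on pairs (G, φ), with G a finite
subset of E and φ in the dual unit ball. The norm is the supremum of the sums of |f| along chains
(Gᵢ, φᵢ) with Gᵢ increasing and φᵢ₊₁ = 0 on Gᵢ. Dividing by the functions that tend to 0 uniformly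
in φ as G grows leaves only the boundary value of a function at large G.

Every g in FBL[E] is such a boundary value. Let A(G) be the supremum of |g| over the functionals in
the ball that vanish on G. A lattice expression in finitely many δ_x vanishes once φ kills those x,
so A(G) tends to 0 (`tendsto_annihilatorSup`). Soft thresholding of g φ at level A(G) therefore has
boundary g. Along a chain its term at i + 1 is at most A(Gᵢ) - A(Gᵢ₊₁), and the sums telescope to at
most ‖g‖ (`sum_abs_thresholdExtension_le`). This gives a lattice homomorphism from FBL[E] to the
quotient. Thresholding is not linear in g. Projectivity supplies a linear lift, hence a bounded
linear map L on E such that L x has boundary δ_x.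

If u is weakly null but not norm null, a gliding hump (`tendsto_zero_of_hasBoundary`) produces a
chain and a subsequence such that the k-th L u is at least about d/3 at the k-th point and
negligible at the others. Summation along the chain is a bounded functional; composed with L it
stays above d/6 on the subsequence, against weak nullity. -/

namespace BLat

/-! ### The chain norm and its Banach lattice. -/

section ChainLattice

variable (E : Type*) [NormedAddCommGroup E] [NormedSpace ℝ E]

/-- Pairs of a finite subset of `E` and a functional in the dual unit ball. -/
abbrev ChainPoint : Type _ := Finset E × Metric.closedBall (0 : StrongDual ℝ E) 1

variable {E}

/-- A sequence `(Gᵢ, φᵢ)` with `Gᵢ` increasing and `φᵢ₊₁` vanishing on `Gᵢ`. -/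
def IsVanishingChain (s : ℕ → ChainPoint E) : Prop :=
  Monotone (fun i => (s i).1) ∧ ∀ i, ∀ x ∈ (s i).1, (s (i + 1)).2.1 x = 0

/-- Continuing with the zero functional meets every vanishing condition. The chain norm thus
dominates each single value, which makes it definite and makes point evaluations bounded. -/
theorem exists_chain_start (w : ChainPoint E) :
    ∃ s : ℕ → ChainPoint E, IsVanishingChain s ∧ s 0 = w := by
  refine ⟨fun i => if i = 0 then w else (w.1, ⟨0, by simp⟩), ⟨?_, fun i x _ => by simp⟩, by simp⟩
  intro i j _
  dsimp only
  split_ifs <;> exact le_rfl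

/-- The supremum of the sums `∑_{i < N} |f (sᵢ)|` over all vanishing chains `s`. -/
noncomputable def chainNorm (f : ChainPoint E → ℝ) : ℝ≥0∞ :=
  ⨆ p : {s : ℕ → ChainPoint E // IsVanishingChain s} × ℕ,
    ∑ i ∈ Finset.range p.2, ‖f (p.1.1 i)‖ₑ

theorem sum_enorm_le_chainNorm (f : ChainPoint E → ℝ) {s : ℕ → ChainPoint E}
    (hs : IsVanishingChain s) (N : ℕ) : ∑ i ∈ Finset.range N, ‖f (s i)‖ₑ ≤ chainNorm f :=
  le_iSup (fun p : {s : ℕ → ChainPoint E // IsVanishingChain s} × ℕ =>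
    ∑ i ∈ Finset.range p.2, ‖f (p.1.1 i)‖ₑ) (⟨s, hs⟩, N)

theorem enorm_apply_le_chainNorm (f : ChainPoint E → ℝ) (w : ChainPoint E) :
    ‖f w‖ₑ ≤ chainNorm f := by
  obtain ⟨s, hs, rfl⟩ := exists_chain_start w
  simpa using sum_enorm_le_chainNorm f hs 1

theorem chainNorm_mono {f g : ChainPoint E → ℝ} (h : ∀ w, |f w| ≤ |g w|) :
    chainNorm f ≤ chainNorm g :=
  iSup_mono fun _ => Finset.sum_le_sum fun _ _ => enorm_le_iff_norm_le.2 (h _)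

theorem chainNorm_add_le (f g : ChainPoint E → ℝ) :
    chainNorm (f + g) ≤ chainNorm f + chainNorm g := by
  refine iSup_le fun p => ?_
  refine (Finset.sum_le_sum fun i _ => enorm_add_le (f (p.1.1 i)) (g (p.1.1 i))).trans ?_
  rw [Finset.sum_add_distrib]
  exact add_le_add (sum_enorm_le_chainNorm f p.1.2 _) (sum_enorm_le_chainNorm g p.1.2 _)

theorem chainNorm_smul (c : ℝ) (f : ChainPoint E → ℝ) :
    chainNorm (c • f) = ‖c‖ₑ * chainNorm f := by
  simp only [chainNorm, Pi.smul_apply, enorm_smul, ← Finset.mul_sum, ENNReal.mul_iSup]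

theorem chainNorm_zero : chainNorm (0 : ChainPoint E → ℝ) = 0 := by
  simp [chainNorm]

theorem chainNorm_abs_add_abs_lt_top {f g : ChainPoint E → ℝ} (hf : chainNorm f < ⊤)
    (hg : chainNorm g < ⊤) : chainNorm (fun w => |f w| + |g w|) < ⊤ := by
  refine (chainNorm_add_le (fun w => |f w|) (fun w => |g w|)).trans_lt
    (ENNReal.add_lt_top.2 ⟨?_, ?_⟩)
  · exact (chainNorm_mono fun w => (abs_abs (f w)).le).trans_lt hf
  · exact (chainNorm_mono fun w => (abs_abs (g w)).le).trans_lt hg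

variable (E)

/-- The vector lattice of functions of finite chain norm. -/
def chainSublattice : VectorSublattice (ChainPoint E → ℝ) where
  carrier := {f | chainNorm f < ⊤}
  zero_mem' := by simp [chainNorm_zero]
  add_mem' {f g} hf hg := (chainNorm_add_le f g).trans_lt (ENNReal.add_lt_top.2 ⟨hf, hg⟩)
  smul_mem' r f hf := by
    change chainNorm (r • f) < ⊤
    rw [chainNorm_smul]
    exact ENNReal.mul_lt_top enorm_lt_top hf
  sup_mem' f hf g hg := (chainNorm_mono fun w => abs_max_le_max_abs_abs.trans
    ((max_le_add_of_nonneg (abs_nonneg _) (abs_nonneg _)).trans (le_abs_self _))).trans_lt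
    (chainNorm_abs_add_abs_lt_top hf hg)
  inf_mem' f hf g hg := (chainNorm_mono fun w => abs_min_le_max_abs_abs.trans
    ((max_le_add_of_nonneg (abs_nonneg _) (abs_nonneg _)).trans (le_abs_self _))).trans_lt
    (chainNorm_abs_add_abs_lt_top hf hg)

/-- The Banach lattice of functions of finite chain norm. -/
def ChainFun : Type _ := (chainSublattice E).toSubmodule

namespace ChainFun

instance : AddCommGroup (ChainFun E) :=
  inferInstanceAs (AddCommGroup (chainSublattice E).toSubmodule)

instance : Module ℝ (ChainFun E) := inferInstanceAs (Module ℝ (chainSublattice E).toSubmodule)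

instance : Lattice (ChainFun E) := inferInstanceAs (Lattice (chainSublattice E).toSubmodule)

instance : IsOrderedAddMonoid (ChainFun E) :=
  inferInstanceAs (IsOrderedAddMonoid (chainSublattice E).toSubmodule)

instance : IsOrderedModule ℝ (ChainFun E) :=
  letI : IsOrderedModule ℝ (ChainPoint E → ℝ) :=
    { smul_le_smul_of_nonneg_left := fun _ hr _ _ h w => mul_le_mul_of_nonneg_left (h w) hr
      smul_le_smul_of_nonneg_right := fun _ hf _ _ h w => mul_le_mul_of_nonneg_right h (hf w) }
  inferInstanceAs (IsOrderedModule ℝ (chainSublattice E).toSubmodule)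

variable {E}

theorem chainNorm_ne_top (f : ChainFun E) : chainNorm f.1 ≠ ⊤ := ne_of_lt f.2

theorem abs_apply_le_toReal (f : ChainFun E) (w : ChainPoint E) :
    |f.1 w| ≤ (chainNorm f.1).toReal := by
  simpa using ENNReal.toReal_mono f.chainNorm_ne_top (enorm_apply_le_chainNorm f.1 w)

variable (E)

noncomputable instance : NormedAddCommGroup (ChainFun E) :=
  AddGroupNorm.toNormedAddCommGroup
    { toFun := fun f => (chainNorm f.1).toReal
      map_zero' := by
        change (chainNorm (0 : ChainPoint E → ℝ)).toReal = 0
        simp [chainNorm_zero]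
      add_le' := fun f g => by
        rw [← ENNReal.toReal_add f.chainNorm_ne_top g.chainNorm_ne_top]
        exact ENNReal.toReal_mono (ENNReal.add_ne_top.2 ⟨f.chainNorm_ne_top, g.chainNorm_ne_top⟩)
          (chainNorm_add_le f.1 g.1)
      neg' := fun f => by
        congr 1
        exact le_antisymm (chainNorm_mono fun w => (abs_neg (f.1 w)).le)
          (chainNorm_mono fun w => (abs_neg (f.1 w)).ge)
      eq_zero_of_map_eq_zero' := fun f hf => by
        refine Subtype.ext (funext fun w => ?_)
        have hf' : (chainNorm f.1).toReal = 0 := hf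
        exact abs_nonpos_iff.1 (hf' ▸ f.abs_apply_le_toReal w) }

variable {E}

theorem norm_def (f : ChainFun E) : ‖f‖ = (chainNorm f.1).toReal := rfl

theorem abs_apply_le (f : ChainFun E) (w : ChainPoint E) : |f.1 w| ≤ ‖f‖ :=
  f.abs_apply_le_toReal w

theorem enorm_eq (f : ChainFun E) : ‖f‖ₑ = chainNorm f.1 := by
  rw [← ofReal_norm, norm_def, ENNReal.ofReal_toReal f.chainNorm_ne_top]

theorem sum_abs_le (f : ChainFun E) {s : ℕ → ChainPoint E} (hs : IsVanishingChain s) (N : ℕ) :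
    ∑ i ∈ Finset.range N, |f.1 (s i)| ≤ ‖f‖ := by
  have h := ENNReal.toReal_mono f.chainNorm_ne_top (sum_enorm_le_chainNorm f.1 hs N)
  rw [ENNReal.toReal_sum fun _ _ => enorm_ne_top] at h
  simpa [norm_def] using h

/-- A function whose sums along vanishing chains are bounded by `C` has chain norm at most `C`. -/
theorem chainNorm_le_ofReal {f : ChainPoint E → ℝ} {C : ℝ}
    (h : ∀ s : ℕ → ChainPoint E, IsVanishingChain s → ∀ N,
      ∑ i ∈ Finset.range N, |f (s i)| ≤ C) : chainNorm f ≤ ENNReal.ofReal C := by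
  refine iSup_le fun p => ?_
  refine le_trans (le_of_eq ?_) (ENNReal.ofReal_le_ofReal (h _ p.1.2 p.2))
  rw [ENNReal.ofReal_sum_of_nonneg fun _ _ => abs_nonneg _]
  exact Finset.sum_congr rfl fun i _ => Real.enorm_eq_ofReal_abs _

variable (E)

noncomputable instance : NormedSpace ℝ (ChainFun E) where
  norm_smul_le c f := by
    rw [norm_def, norm_def]
    change (chainNorm (c • f.1)).toReal ≤ _
    rw [chainNorm_smul, ENNReal.toReal_mul, toReal_enorm]

instance : HasSolidNorm (ChainFun E) where
  solid _ g h := ENNReal.toReal_mono g.chainNorm_ne_top (chainNorm_mono h)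

/-- The limit is taken pointwise. Since the chain norm is a supremum of finite sums, upper bounds on
it survive pointwise limits. -/
instance : CompleteSpace (ChainFun E) := by
  refine Metric.complete_of_cauchySeq_tendsto fun u hu => ?_
  have hc : ∀ w, CauchySeq fun n => (u n).1 w := by
    intro w
    rw [Metric.cauchySeq_iff'] at hu ⊢
    intro ε hε
    obtain ⟨N, hN⟩ := hu ε hε
    refine ⟨N, fun n hn => ?_⟩
    have h2 := hN n hn
    rw [dist_eq_norm] at h2
    exact (abs_apply_le (u n - u N) w).trans_lt h2
  choose F hF using fun w => cauchySeq_tendsto_of_complete (hc w)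
  have key : ∀ ε : ℝ≥0∞, 0 < ε → ∃ N, ∀ n ≥ N, chainNorm (fun w => (u n).1 w - F w) ≤ ε := by
    intro ε hε
    obtain ⟨N, hN⟩ := EMetric.cauchySeq_iff.1 hu ε hε
    refine ⟨N, fun n hn => iSup_le fun p => ?_⟩
    have hlim : Tendsto
        (fun m => ∑ i ∈ Finset.range p.2, ‖(u n).1 (p.1.1 i) - (u m).1 (p.1.1 i)‖ₑ) atTop
        (𝓝 (∑ i ∈ Finset.range p.2, ‖(u n).1 (p.1.1 i) - F (p.1.1 i)‖ₑ)) :=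
      tendsto_finsetSum _ fun i _ => (tendsto_const_nhds.sub (hF _)).enorm
    refine le_of_tendsto hlim (eventually_atTop.2 ⟨N, fun m hm => ?_⟩)
    have h1 := (hN n hn m hm).le
    rw [edist_eq_enorm_sub, enorm_eq] at h1
    exact (sum_enorm_le_chainNorm (u n - u m).1 p.1.2 p.2).trans h1
  have hmem : F ∈ (chainSublattice E).toSubmodule := by
    obtain ⟨N, hN⟩ := key 1 one_pos
    have e : F = (u N).1 + (-1 : ℝ) • fun w => (u N).1 w - F w := by
      ext w; simp
    change chainNorm F < ⊤
    rw [e]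
    refine (chainNorm_add_le _ _).trans_lt (ENNReal.add_lt_top.2 ⟨(u N).2, ?_⟩)
    rw [chainNorm_smul]
    exact ENNReal.mul_lt_top enorm_lt_top ((hN N le_rfl).trans_lt ENNReal.one_lt_top)
  let f : ChainFun E := ⟨F, hmem⟩
  refine ⟨f, EMetric.tendsto_atTop.2 fun ε hε => ?_⟩
  obtain ⟨δ, hδ, hδε⟩ := exists_between hε
  obtain ⟨N, hN⟩ := key δ hδ
  refine ⟨N, fun n hn => ?_⟩
  rw [edist_eq_enorm_sub, enorm_eq]
  exact (hN n hn).trans_lt hδε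

variable {E}

/-- Evaluation at a point is a bounded functional. -/
noncomputable def evalCLM (w : ChainPoint E) : StrongDual ℝ (ChainFun E) :=
  LinearMap.mkContinuous
    { toFun := fun f => f.1 w
      map_add' := fun _ _ => rfl
      map_smul' := fun _ _ => rfl } 1 fun f => by
    rw [one_mul]; exact f.abs_apply_le w

theorem summable_chain (f : ChainFun E) {s : ℕ → ChainPoint E} (hs : IsVanishingChain s) :
    Summable fun i => f.1 (s i) :=
  (summable_of_sum_range_le (fun _ => abs_nonneg _) (f.sum_abs_le hs)).of_abs

/-- Summation along a vanishing chain is a bounded functional. -/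
noncomputable def chainSumCLM {s : ℕ → ChainPoint E} (hs : IsVanishingChain s) :
    StrongDual ℝ (ChainFun E) :=
  LinearMap.mkContinuous
    { toFun := fun f => ∑' i, f.1 (s i)
      map_add' := fun f g => (f.summable_chain hs).tsum_add (g.summable_chain hs)
      map_smul' := fun c f => (f.summable_chain hs).tsum_const_smul c } 1 fun f => by
    rw [one_mul]
    refine (norm_tsum_le_tsum_norm (f.summable_chain hs).norm).trans ?_
    exact Real.tsum_le_of_sum_range_le (fun _ => abs_nonneg _) (f.sum_abs_le hs)

end ChainFun

end ChainLattice

end BLat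

namespace BLat

/-! ### Boundary values and the quotient. -/

section Lift

variable {E : Type*} [NormedAddCommGroup E] [NormedSpace ℝ E]

/-- `f (G, φ)` converges to `g φ` as the finite set `G` grows, uniformly in `φ`. -/
def HasBoundary (f : ChainPoint E → ℝ) (g : StrongDual ℝ E → ℝ) : Prop :=
  ∀ ε > 0, ∀ᶠ G in atTop, ∀ φ, |f (G, φ) - g φ.1| ≤ ε

/-- Addition, subtraction, supremum and infimum all have error at most the sum of the two errors, so
this one estimate serves for the four of them. -/
theorem HasBoundary.of_abs_sub_le {f f₁ f₂ : ChainPoint E → ℝ} {g g₁ g₂ : StrongDual ℝ E → ℝ}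
    (h₁ : HasBoundary f₁ g₁) (h₂ : HasBoundary f₂ g₂)
    (h : ∀ w, |f w - g w.2.1| ≤ |f₁ w - g₁ w.2.1| + |f₂ w - g₂ w.2.1|) : HasBoundary f g := by
  intro ε hε
  filter_upwards [h₁ (ε / 2) (half_pos hε), h₂ (ε / 2) (half_pos hε)] with G hG₁ hG₂ φ
  linarith [h (G, φ), hG₁ φ, hG₂ φ]

theorem HasBoundary.add {f₁ f₂ : ChainPoint E → ℝ} {g₁ g₂ : StrongDual ℝ E → ℝ}
    (h₁ : HasBoundary f₁ g₁) (h₂ : HasBoundary f₂ g₂) : HasBoundary (f₁ + f₂) (g₁ + g₂) :=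
  h₁.of_abs_sub_le h₂ fun w => by
    simpa [add_sub_add_comm] using abs_add_le (f₁ w - g₁ w.2.1) (f₂ w - g₂ w.2.1)

theorem HasBoundary.sub {f₁ f₂ : ChainPoint E → ℝ} {g₁ g₂ : StrongDual ℝ E → ℝ}
    (h₁ : HasBoundary f₁ g₁) (h₂ : HasBoundary f₂ g₂) : HasBoundary (f₁ - f₂) (g₁ - g₂) :=
  h₁.of_abs_sub_le h₂ fun w => by
    simpa [sub_sub_sub_comm] using abs_sub (f₁ w - g₁ w.2.1) (f₂ w - g₂ w.2.1)

theorem HasBoundary.sup {f₁ f₂ : ChainPoint E → ℝ} {g₁ g₂ : StrongDual ℝ E → ℝ}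
    (h₁ : HasBoundary f₁ g₁) (h₂ : HasBoundary f₂ g₂) : HasBoundary (f₁ ⊔ f₂) (g₁ ⊔ g₂) :=
  h₁.of_abs_sub_le h₂ fun _ => abs_sup_sub_sup_le _ _ _ _

theorem HasBoundary.inf {f₁ f₂ : ChainPoint E → ℝ} {g₁ g₂ : StrongDual ℝ E → ℝ}
    (h₁ : HasBoundary f₁ g₁) (h₂ : HasBoundary f₂ g₂) : HasBoundary (f₁ ⊓ f₂) (g₁ ⊓ g₂) :=
  h₁.of_abs_sub_le h₂ fun _ => abs_inf_sub_inf_le _ _ _ _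

theorem HasBoundary.zero : HasBoundary (0 : ChainPoint E → ℝ) 0 := fun ε hε =>
  Eventually.of_forall fun _ _ => by simpa using hε.le

theorem HasBoundary.smul {f : ChainPoint E → ℝ} {g : StrongDual ℝ E → ℝ} (c : ℝ)
    (h : HasBoundary f g) : HasBoundary (c • f) (c • g) := by
  intro ε hε
  filter_upwards [h (ε / (|c| + 1)) (by positivity)] with G hG φ
  have h1 := hG φ
  rw [le_div_iff₀ (by positivity)] at h1
  have h2 : (c • f) (G, φ) - (c • g) φ.1 = c * (f (G, φ) - g φ.1) := by
    simp [mul_sub]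
  rw [h2, abs_mul]
  nlinarith [abs_nonneg (f (G, φ) - g φ.1)]

variable (E)

/-- The closed ideal of functions with zero boundary. -/
def boundaryIdeal : ClosedIdeal (ChainFun E) where
  carrier := {f | HasBoundary f.1 0}
  zero_mem' := HasBoundary.zero
  add_mem' {f g} hf hg := by
    have h := HasBoundary.add hf hg
    rw [add_zero] at h
    exact h
  smul_mem' c f hf := by
    have h := HasBoundary.smul c hf
    rw [smul_zero] at h
    exact h
  solid' := fun f hf g hgf ε hε => by
    filter_upwards [hf ε hε] with G hG φ
    have h1 : |g.1 (G, φ)| ≤ |f.1 (G, φ)| := hgf (G, φ)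
    have h2 := hG φ
    simp only [Pi.zero_apply, sub_zero] at h2 ⊢
    exact h1.trans h2
  closed' := by
    -- The chain norm dominates the supremum norm, and uniform limits preserve vanishing at the
    -- boundary.
    refine isClosed_of_closure_subset fun f hf ε hε => ?_
    obtain ⟨g, hg, hfg⟩ := Metric.mem_closure_iff.1 hf (ε / 2) (half_pos hε)
    rw [dist_eq_norm] at hfg
    filter_upwards [hg (ε / 2) (half_pos hε)] with G hG φ
    have h1 : |f.1 (G, φ) - g.1 (G, φ)| ≤ ‖f - g‖ := (f - g).abs_apply_le (G, φ)
    have h2 := hG φ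
    simp only [Pi.zero_apply, sub_zero] at h2 ⊢
    have h3 := abs_sub_abs_le_abs_sub (f.1 (G, φ)) (g.1 (G, φ))
    linarith

variable {E}

theorem mkQ_eq_of_hasBoundary {f₁ f₂ : ChainFun E} {g : StrongDual ℝ E → ℝ}
    (h₁ : HasBoundary f₁.1 g) (h₂ : HasBoundary f₂.1 g) :
    (boundaryIdeal E).toSubmodule.mkQ f₁ = (boundaryIdeal E).toSubmodule.mkQ f₂ := by
  refine (Submodule.Quotient.eq _).2 ?_
  have h := h₁.sub h₂
  rw [sub_self] at h
  exact h

/-- This reads off the boundary of an abstract lift, about which only its class is known. -/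
theorem HasBoundary.of_mkQ_eq {f₁ f₂ : ChainFun E} {g : StrongDual ℝ E → ℝ}
    (h : (boundaryIdeal E).toSubmodule.mkQ f₁ = (boundaryIdeal E).toSubmodule.mkQ f₂)
    (h₂ : HasBoundary f₂.1 g) : HasBoundary f₁.1 g := by
  have h' : HasBoundary (f₁.1 - f₂.1) 0 := (Submodule.Quotient.eq _).1 h
  simpa using h'.add h₂

/-! ### Size on annihilators of finite sets. -/

/-- The functionals in the dual unit ball vanishing on `G`. -/
abbrev BallAnnihilator (G : Finset E) : Type _ :=
  {φ : StrongDual ℝ E // ‖φ‖ ≤ 1 ∧ ∀ x ∈ G, φ x = 0}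

/-- The supremum of `|g φ|` over the functionals in the dual unit ball vanishing on `G`. -/
noncomputable def annihilatorSup (g : HomFun E) (G : Finset E) : ℝ :=
  ⨆ φ : BallAnnihilator G, |g.1 φ.1|

theorem HomFun.abs_apply_le_norm (g : HomFun E) {φ : StrongDual ℝ E} (h : ‖φ‖ ≤ 1) :
    |g.1 φ| ≤ ‖g‖ :=
  (g.abs_apply_le φ).trans (mul_le_of_le_one_left (norm_nonneg g) h)

theorem abs_apply_le_annihilatorSup (g : HomFun E) {G : Finset E} {φ : StrongDual ℝ E}
    (h : ‖φ‖ ≤ 1) (hG : ∀ x ∈ G, φ x = 0) : |g.1 φ| ≤ annihilatorSup g G := by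
  refine le_ciSup (f := fun φ : BallAnnihilator G => |g.1 φ.1|) ⟨‖g‖, ?_⟩ ⟨φ, h, hG⟩
  rintro _ ⟨ψ, rfl⟩
  exact g.abs_apply_le_norm ψ.2.1

theorem annihilatorSup_le {g : HomFun E} {G : Finset E} {C : ℝ}
    (h : ∀ φ : StrongDual ℝ E, ‖φ‖ ≤ 1 → (∀ x ∈ G, φ x = 0) → |g.1 φ| ≤ C) :
    annihilatorSup g G ≤ C :=
  have : Nonempty (BallAnnihilator G) := ⟨⟨0, by simp⟩⟩
  ciSup_le fun φ => h φ.1 φ.2.1 φ.2.2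

theorem annihilatorSup_nonneg (g : HomFun E) (G : Finset E) : 0 ≤ annihilatorSup g G :=
  Real.iSup_nonneg fun _ => abs_nonneg _

theorem annihilatorSup_anti (g : HomFun E) : Antitone (annihilatorSup g) := fun _ _ hGH =>
  annihilatorSup_le fun _ h h' => abs_apply_le_annihilatorSup g h fun x hx => h' x (hGH hx)

theorem annihilatorSup_le_norm (g : HomFun E) (G : Finset E) : annihilatorSup g G ≤ ‖g‖ :=
  annihilatorSup_le fun _ h _ => g.abs_apply_le_norm h

variable (E)

/-- The functions that are small on annihilators of large finite sets. -/
def smallAtAnnihilators : VectorSublattice (HomFun E) where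
  carrier := {g | ∀ ε > 0, ∃ G : Finset E, ∀ φ : StrongDual ℝ E, ‖φ‖ ≤ 1 →
    (∀ x ∈ G, φ x = 0) → |g.1 φ| ≤ ε}
  zero_mem' ε hε := ⟨∅, fun φ _ _ => by
    change |(0 : ℝ)| ≤ ε
    simpa using hε.le⟩
  add_mem' {f g} hf hg ε hε := by
    classical
    obtain ⟨F, hF⟩ := hf (ε / 2) (half_pos hε)
    obtain ⟨G, hG⟩ := hg (ε / 2) (half_pos hε)
    refine ⟨F ∪ G, fun φ h h' => (abs_add_le (f.1 φ) (g.1 φ)).trans ?_⟩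
    linarith [hF φ h fun x hx => h' x (Finset.mem_union_left _ hx),
      hG φ h fun x hx => h' x (Finset.mem_union_right _ hx)]
  smul_mem' c f hf ε hε := by
    obtain ⟨F, hF⟩ := hf (ε / (|c| + 1)) (by positivity)
    refine ⟨F, fun φ h h' => ?_⟩
    have h1 := hF φ h h'
    rw [le_div_iff₀ (by positivity)] at h1
    change |c * f.1 φ| ≤ ε
    rw [abs_mul]
    nlinarith [abs_nonneg (f.1 φ)]
  sup_mem' f hf g hg ε hε := by
    classical
    obtain ⟨F, hF⟩ := hf ε hε
    obtain ⟨G, hG⟩ := hg ε hε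
    exact ⟨F ∪ G, fun φ h h' => abs_max_le_max_abs_abs.trans (max_le
      (hF φ h fun x hx => h' x (Finset.mem_union_left _ hx))
      (hG φ h fun x hx => h' x (Finset.mem_union_right _ hx)))⟩
  inf_mem' f hf g hg ε hε := by
    classical
    obtain ⟨F, hF⟩ := hf ε hε
    obtain ⟨G, hG⟩ := hg ε hε
    exact ⟨F ∪ G, fun φ h h' => abs_min_le_max_abs_abs.trans (max_le
      (hF φ h fun x hx => h' x (Finset.mem_union_left _ hx))
      (hG φ h fun x hx => h' x (Finset.mem_union_right _ hx)))⟩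

variable {E}

/-- Each δ_x vanishes on the annihilator of {x}, so `smallAtAnnihilators` contains the generated
vector lattice. Passing to the norm closure costs at most ‖g - f‖ uniformly on the dual ball. -/
theorem tendsto_annihilatorSup (g : FBL E) : Tendsto (annihilatorSup g.1) atTop (𝓝 0) := by
  refine Metric.tendsto_nhds.2 fun ε hε => ?_
  obtain ⟨f, hf, hgf⟩ := Metric.mem_closure_iff.1 g.2 (ε / 4)
    (by positivity)
  have hf' : f ∈ (smallAtAnnihilators E).carrier := hf (smallAtAnnihilators E) (by
    rintro _ ⟨x, rfl⟩ ε hε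
    refine ⟨{x}, fun φ _ h' => ?_⟩
    change |φ x| ≤ ε
    simpa [h' x (by simp)] using hε.le)
  obtain ⟨G, hG⟩ := hf' (ε / 4) (by positivity)
  filter_upwards [eventually_ge_atTop G] with H hH
  rw [Real.dist_eq, sub_zero, abs_of_nonneg (annihilatorSup_nonneg _ _)]
  refine ((annihilatorSup_anti g.1 hH).trans (annihilatorSup_le (C := ε / 2)
    fun φ h h' => ?_)).trans_lt (half_lt_self hε)
  rw [dist_eq_norm] at hgf
  have h1 : |g.1.1 φ - f.1 φ| ≤ ‖g.1 - f‖ := (g.1 - f).abs_apply_le_norm h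
  linarith [abs_sub_abs_le_abs_sub (g.1.1 φ) (f.1 φ), hG φ h h']

/-! ### Thresholded extensions and the induced homomorphism. -/

/-- Soft thresholding of `t` at level `e`. -/
def softThreshold (t e : ℝ) : ℝ := max (t - e) 0 - max (-t - e) 0

theorem abs_softThreshold_sub_le (t : ℝ) {e : ℝ} (he : 0 ≤ e) : |softThreshold t e - t| ≤ e := by
  unfold softThreshold
  rw [abs_le]
  rcases max_cases (t - e) 0 with h | h <;> rcases max_cases (-t - e) 0 with h' | h' <;>
    constructor <;> linarith

theorem abs_softThreshold (t : ℝ) {e : ℝ} (he : 0 ≤ e) :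
    |softThreshold t e| = max (|t| - e) 0 := by
  unfold softThreshold
  rcases le_total 0 t with ht | ht
  · rw [abs_of_nonneg ht, max_eq_right (by linarith : -t - e ≤ 0), sub_zero,
      abs_of_nonneg (le_max_right _ _)]
  · rw [abs_of_nonpos ht, max_eq_right (by linarith : t - e ≤ 0), zero_sub, abs_neg,
      abs_of_nonneg (le_max_right _ _)]

/-- The function `g φ` thresholded at the size of `g` on the annihilator of `G`. -/
noncomputable def thresholdExtension (g : HomFun E) (w : ChainPoint E) : ℝ :=
  softThreshold (g.1 w.2.1) (annihilatorSup g w.1)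

theorem sum_abs_thresholdExtension_le (g : HomFun E) {s : ℕ → ChainPoint E}
    (hs : IsVanishingChain s) (N : ℕ) :
    ∑ i ∈ Finset.range N, |thresholdExtension g (s i)| ≤ ‖g‖ := by
  have hb : ∀ i, ‖(s i).2.1‖ ≤ 1 := fun i => mem_closedBall_zero_iff.1 (s i).2.2
  -- Subtracting the current annihilator supremum makes the induction close: φₙ₊₁ vanishes on Gₙ, so
  -- the next term is at most the drop of that supremum from Gₙ to Gₙ₊₁. The first functional is
  -- unconstrained and is controlled by ‖g‖.
  have key : ∀ n, ∑ i ∈ Finset.range (n + 1), |thresholdExtension g (s i)| ≤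
      ‖g‖ - annihilatorSup g (s n).1 := by
    intro n
    induction n with
    | zero =>
      rw [zero_add, Finset.sum_range_one, thresholdExtension,
        abs_softThreshold _ (annihilatorSup_nonneg _ _)]
      exact max_le (by linarith [g.abs_apply_le_norm (hb 0)])
        (by linarith [annihilatorSup_le_norm g (s 0).1])
    | succ n ih =>
      rw [Finset.sum_range_succ, thresholdExtension,
        abs_softThreshold _ (annihilatorSup_nonneg _ _)]
      have h1 := abs_apply_le_annihilatorSup g (hb (n + 1)) (hs.2 n)
      have h2 := annihilatorSup_anti g (hs.1 (Nat.le_succ n))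
      have h3 : max (|g.1 (s (n + 1)).2.1| - annihilatorSup g (s (n + 1)).1) 0 ≤
          annihilatorSup g (s n).1 - annihilatorSup g (s (n + 1)).1 :=
        max_le (by linarith) (by simpa using h2)
      linarith
  rcases N with _ | n
  · simp
  · linarith [key n, annihilatorSup_nonneg g (s n).1]

theorem exists_extension (g : FBL E) :
    ∃ f : ChainFun E, HasBoundary f.1 g.1.1 ∧ ‖f‖ ≤ ‖g‖ := by
  have h := ChainFun.chainNorm_le_ofReal fun s hs => sum_abs_thresholdExtension_le g.1 hs
  refine ⟨⟨thresholdExtension g.1, h.trans_lt ENNReal.ofReal_lt_top⟩, fun ε hε => ?_, ?_⟩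
  · filter_upwards [(tendsto_annihilatorSup g).eventually (ge_mem_nhds hε)] with G hG φ
    exact (abs_softThreshold_sub_le _ (annihilatorSup_nonneg _ _)).trans hG
  · have := ENNReal.toReal_mono ENNReal.ofReal_ne_top h
    rwa [ENNReal.toReal_ofReal (norm_nonneg _)] at this

/-- A function on the chain points with boundary `g`. -/
noncomputable def extension (g : FBL E) : ChainFun E := (exists_extension g).choose

theorem hasBoundary_extension (g : FBL E) : HasBoundary (extension g).1 g.1.1 :=
  (exists_extension g).choose_spec.1

theorem norm_extension_le (g : FBL E) : ‖extension g‖ ≤ ‖g‖ :=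
  (exists_extension g).choose_spec.2

variable (E)

/-- The lattice homomorphism from `FBL[E]` to the quotient by the boundary ideal that sends `g` to
the class of the functions with boundary `g`. -/
noncomputable def boundaryHom : FBL E →L[ℝ] ChainFun E ⧸ (boundaryIdeal E).toSubmodule :=
  LinearMap.mkContinuous
    { toFun := fun g => (boundaryIdeal E).toSubmodule.mkQ (extension g)
      map_add' := fun f g => by
        rw [← map_add]
        exact mkQ_eq_of_hasBoundary (hasBoundary_extension (f + g))
          ((hasBoundary_extension f).add (hasBoundary_extension g))
      map_smul' := fun c g => by
        rw [← map_smul]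
        exact mkQ_eq_of_hasBoundary (hasBoundary_extension (c • g))
          ((hasBoundary_extension g).smul c) } 1 fun g => by
    rw [one_mul]
    exact (Submodule.Quotient.norm_mk_le _ _).trans (norm_extension_le g)

/-- Although `extension` is an arbitrary choice, the class depends only on the boundary, and
boundaries respect the lattice operations. -/
theorem isLatticeHom_boundaryHom : IsLatticeHom (boundaryHom E) := by
  constructor <;> intro f g
  · exact (mkQ_eq_of_hasBoundary (hasBoundary_extension (f ⊔ g))
      ((hasBoundary_extension f).sup (hasBoundary_extension g))).trans (mkQ_sup _ _ _)
  · exact (mkQ_eq_of_hasBoundary (hasBoundary_extension (f ⊓ g))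
      ((hasBoundary_extension f).inf (hasBoundary_extension g))).trans (mkQ_inf _ _ _)

end Lift

end BLat

namespace BLat

/-! ### Weakly null sequences and finite-dimensional subspaces. -/

section WeaklyNull

variable {E : Type*} [NormedAddCommGroup E] [NormedSpace ℝ E]

/-- Uniform boundedness applies to the terms as functionals on the complete space E*, and the
embedding in the bidual is isometric. -/
theorem exists_norm_le_of_weaklyNull {u : ℕ → E}
    (hu : ∀ ψ : StrongDual ℝ E, Tendsto (fun n => ψ (u n)) atTop (𝓝 0)) :
    ∃ C, ∀ n, ‖u n‖ ≤ C := by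
  obtain ⟨C, hC⟩ := banach_steinhaus
    (g := fun n => NormedSpace.inclusionInDoubleDual ℝ E (u n)) fun ψ => by
      obtain ⟨C, hC⟩ := (hu ψ).norm.bddAbove_range
      exact ⟨C, fun n => hC ⟨n, rfl⟩⟩
  exact ⟨C, fun n => by
    rw [← (NormedSpace.inclusionInDoubleDualLi ℝ (E := E)).norm_map (u n)]
    exact hC n⟩

/-- A functional in the dual unit ball that annihilates `G` and is at least `d` at `x` exists as
soon as `x` is at distance at least `d` from the span of `G`. -/
theorem exists_annihilating_of_forall_dist {G : Finset E} {x : E} {d : ℝ}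
    (h : ∀ v ∈ Submodule.span ℝ (G : Set E), d ≤ ‖x - v‖) :
    ∃ φ : StrongDual ℝ E, ‖φ‖ ≤ 1 ∧ (∀ y ∈ G, φ y = 0) ∧ d ≤ φ x := by
  set V := Submodule.span ℝ (G : Set E)
  have : FiniteDimensional ℝ V := FiniteDimensional.span_finset ℝ G
  have : IsClosed (V : Set E) := V.closed_of_finiteDimensional
  -- A functional norming the class of x in E ⧸ V, pulled back to E, annihilates G; the quotient
  -- norm of x is its distance to V.
  obtain ⟨ψ, hψ, hψx⟩ := exists_dual_vector'' ℝ (V.mkQ x)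
  let π : E →L[ℝ] E ⧸ V := LinearMap.mkContinuous V.mkQ 1 fun y => by
    rw [one_mul]; exact Submodule.Quotient.norm_mk_le V y
  refine ⟨ψ.comp π, ?_, fun y hy => ?_, ?_⟩
  · refine (ψ.opNorm_comp_le π).trans (mul_le_one₀ hψ (norm_nonneg _) ?_)
    exact LinearMap.mkContinuous_norm_le _ zero_le_one _
  · have : π y = 0 := (Submodule.Quotient.mk_eq_zero V).2 (Submodule.subset_span hy)
    simp [this]
  · change d ≤ ψ (V.mkQ x)
    rw [hψx]
    refine le_of_forall_pos_le_add fun ε hε => ?_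
    obtain ⟨y, hy, hyε⟩ := Submodule.Quotient.norm_mk_lt (S := V) (V.mkQ x) hε
    have h1 : x - y ∈ V := (Submodule.Quotient.eq V).1 hy.symm
    have h2 := h _ h1
    rw [sub_sub_cancel] at h2
    exact h2.trans hyε.le

/-- The terms of a weakly null sequence with norm at least `d` are eventually `d / 3`-separated
from a given finite-dimensional subspace. -/
theorem eventually_exists_annihilating {u : ℕ → E}
    (hu : ∀ ψ : StrongDual ℝ E, Tendsto (fun n => ψ (u n)) atTop (𝓝 0)) {d : ℝ} (hd : 0 < d)
    (G : Finset E) : ∀ᶠ n in atTop, d ≤ ‖u n‖ →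
      ∃ φ : StrongDual ℝ E, ‖φ‖ ≤ 1 ∧ (∀ y ∈ G, φ y = 0) ∧ d / 3 ≤ φ (u n) := by
  -- Otherwise a subsequence stays within d / 3 of a bounded sequence in the span, which clusters at
  -- some w by finite dimension. Then ‖w‖ ≥ 2d / 3, while weak nullity gives ψ w ≤ d / 3 for a
  -- functional ψ norming w.
  by_contra hcon
  rw [not_eventually] at hcon
  obtain ⟨k, hk, hk'⟩ := extraction_of_frequently_atTop hcon
  set V := Submodule.span ℝ (G : Set E)
  have : FiniteDimensional ℝ V := FiniteDimensional.span_finset ℝ G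
  have hv : ∀ n, d ≤ ‖u (k n)‖ ∧ ∃ v : V, ‖u (k n) - v‖ < d / 3 := by
    intro n
    have h1 := hk' n
    rw [Classical.not_imp] at h1
    refine ⟨h1.1, ?_⟩
    by_contra! h2
    exact h1.2 (exists_annihilating_of_forall_dist fun v hv => h2 ⟨v, hv⟩)
  choose hdu v hv using hv
  obtain ⟨C, hC⟩ := exists_norm_le_of_weaklyNull hu
  have hbdd : ∀ n, v n ∈ Metric.closedBall (0 : V) (C + d / 3) := fun n => by
    rw [mem_closedBall_zero_iff]
    have h1 := norm_sub_norm_le (v n : E) (u (k n))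
    rw [norm_sub_rev] at h1
    have h2 : ‖v n‖ = ‖(v n : E)‖ := rfl
    linarith [hC (k n), hv n]
  obtain ⟨w, -, l, hl, hlim⟩ := tendsto_subseq_of_bounded Metric.isBounded_closedBall hbdd
  have hlim' : Tendsto (fun n => (v (l n) : E)) atTop (𝓝 (w : E)) :=
    (continuous_subtype_val.tendsto w).comp hlim
  obtain ⟨ψ, hψ, hψw⟩ := exists_dual_vector'' ℝ (w : E)
  have hkl : Tendsto (fun n => k (l n)) atTop atTop := hk.tendsto_atTop.comp hl.tendsto_atTop
  have h1 : ψ w - 0 ≤ d / 3 := by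
    refine le_of_tendsto (((ψ.continuous.tendsto _).comp hlim').sub ((hu ψ).comp hkl))
      (Eventually.of_forall fun n => ?_)
    change ψ (v (l n)) - ψ (u (k (l n))) ≤ d / 3
    rw [← map_sub]
    refine (le_abs_self _).trans ((ψ.le_of_opNorm_le hψ _).trans ?_)
    rw [one_mul, norm_sub_rev]
    exact (hv _).le
  have h2 : d - d / 3 ≤ ‖(w : E)‖ := by
    refine ge_of_tendsto hlim'.norm (Eventually.of_forall fun n => ?_)
    have h3 := norm_sub_norm_le (u (k (l n))) (v (l n) : E)
    linarith [hv (l n), hdu (l n)]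
  rw [hψw] at h1
  simp only [RCLike.ofReal_real_eq_id, id_eq] at h1
  linarith

end WeaklyNull

/-! ### The gliding hump and the Schur property. -/

section Schur

variable {E : Type*} [NormedAddCommGroup E] [NormedSpace ℝ E]

theorem norm_evalAt_le (x : E) : ‖evalAt x‖ ≤ ‖x‖ := by
  have h : fblNorm (evalAt x).1 ≤ ENNReal.ofReal ‖x‖ := by
    refine iSup_le fun p => ?_
    have h : ∑ i, |p.1.2 i x| ≤ ‖x‖ := by
      rcases eq_or_ne x 0 with rfl | hx
      · simp
      · have h0 : 0 < ‖x‖ := norm_pos_iff.2 hx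
        have h1 := p.2 (‖x‖⁻¹ • x) (by rw [norm_smul]; simp [h0.ne'])
        simp only [map_smul, smul_eq_mul, abs_mul, abs_inv, abs_norm, ← Finset.mul_sum] at h1
        rwa [inv_mul_le_iff₀ h0, mul_one] at h1
    refine le_trans (le_of_eq ?_) (ENNReal.ofReal_le_ofReal h)
    rw [ENNReal.ofReal_sum_of_nonneg fun _ _ => abs_nonneg _]
    exact Finset.sum_congr rfl fun i _ => Real.enorm_eq_ofReal_abs _
  exact ENNReal.toReal_le_of_le_ofReal (norm_nonneg _) h

theorem evalAt_mem_fblSublattice (x : E) : evalAt x ∈ (fblSublattice E).toSubmodule :=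
  subset_closure fun _ h => h ⟨x, rfl⟩

/-- The canonical embedding of `E` into `FBL[E]`. -/
noncomputable def evalFBL : E →L[ℝ] FBL E :=
  LinearMap.mkContinuous
    { toFun := fun x => ⟨evalAt x, evalAt_mem_fblSublattice x⟩
      map_add' := fun x y => Subtype.ext (Subtype.ext (funext fun φ => map_add φ x y))
      map_smul' := fun c x => Subtype.ext (Subtype.ext (funext fun φ => map_smul φ c x)) } 1
    fun x => by
      rw [one_mul]
      exact norm_evalAt_le x

/-- If `E` maps boundedly and linearly to `ChainFun E` in such a way that the boundary of the image
of `x` is the evaluation at `x`, then weakly null sequences of `E` are norm null. -/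
theorem tendsto_zero_of_hasBoundary (L : E →L[ℝ] ChainFun E)
    (hL : ∀ x, HasBoundary (L x).1 fun φ => φ x) {u : ℕ → E}
    (hu : ∀ ψ : StrongDual ℝ E, Tendsto (fun n => ψ (u n)) atTop (𝓝 0)) :
    Tendsto u atTop (𝓝 0) := by
  classical
  by_contra hcon
  obtain ⟨d, hd, hfreq⟩ : ∃ d > 0, ∃ᶠ n in atTop, d ≤ ‖u n‖ := by
    rw [Metric.tendsto_nhds] at hcon
    push Not at hcon
    simpa using hcon
  -- The errors c / 2 ^ i add up to 2c = d / 6, half of the main term d / 3.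
  set c : ℝ := d / 12 with hc
  have hc0 : 0 < c := by positivity
  -- Keeping u n inside its own finite set forces all later functionals of the chain to kill it.
  let good : ℕ × ChainPoint E → Prop := fun a =>
    d / 3 - c * (1 / 2) ^ a.1 ≤ (L (u a.1)).1 a.2 ∧ u a.1 ∈ a.2.1
  -- Both error bounds are weighted by the index of the evaluation point, not of the vector, so that
  -- for a fixed vector they are summable over the chain.
  let rel : ℕ × ChainPoint E → ℕ × ChainPoint E → Prop := fun a b =>
    a.1 < b.1 ∧ a.2.1 ⊆ b.2.1 ∧ (∀ x ∈ a.2.1, b.2.2.1 x = 0) ∧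
      |(L (u b.1)).1 a.2| ≤ c * (1 / 2) ^ a.1 ∧ |(L (u a.1)).1 b.2| ≤ c * (1 / 2) ^ b.1
  obtain ⟨a, ha, hab⟩ := exists_seq_of_forall_finset_exists good rel fun S hS => by
    -- Smallness of the new vector at earlier points: evaluation at such a point composed with L is
    -- a functional on E.
    have hpast : ∀ᶠ n in atTop, ∀ b ∈ S, b.1 < n ∧ |(L (u n)).1 b.2| ≤ c * (1 / 2) ^ b.1 := by
      refine (eventually_all_finset S).2 fun b _ => (eventually_gt_atTop b.1).and ?_
      have h := (hu ((ChainFun.evalCLM b.2).comp L)).abs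
      rw [abs_zero] at h
      exact h.eventually (ge_mem_nhds (by positivity))
    set H : Finset E := S.biUnion fun b => b.2.1
    have hH : ∀ b ∈ S, b.2.1 ⊆ H := fun b hb => Finset.subset_biUnion_of_mem (fun b => b.2.1) hb
    obtain ⟨n, hdn, hn, hφ⟩ := (hfreq.and_eventually (hpast.and
      (eventually_exists_annihilating hu hd H))).exists
    obtain ⟨φ, hφ1, hφ0, hφn⟩ := hφ hdn
    have hε : 0 < c * (1 / 2 : ℝ) ^ n := by positivity
    -- For large G the boundary condition takes over: L (u n) at (G, φ) is close to φ (u n) ≥ d / 3,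
    -- and the earlier vectors, which lie in H, give values close to 0.
    obtain ⟨G, hG1, hG2, hG3⟩ := ((eventually_ge_atTop (insert (u n) H)).and
      ((hL (u n) _ hε).and ((eventually_all_finset S).2 fun b _ => hL (u b.1) _ hε))).exists
    have hHG : H ⊆ G := fun x hx => hG1 (Finset.mem_insert_of_mem hx)
    have hnG : u n ∈ G := hG1 (Finset.mem_insert_self _ _)
    let ψ : Metric.closedBall (0 : StrongDual ℝ E) 1 := ⟨φ, mem_closedBall_zero_iff.2 hφ1⟩
    have hlower : d / 3 - c * (1 / 2) ^ n ≤ (L (u n)).1 (G, ψ) := by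
      have h1 : -(c * (1 / 2) ^ n) ≤ (L (u n)).1 (G, ψ) - φ (u n) := (abs_le.1 (hG2 ψ)).1
      linarith
    refine ⟨(n, G, ψ), ⟨hlower, hnG⟩, fun b hb => ⟨(hn b hb).1, fun x hx => hHG (hH b hb hx),
      fun x hx => hφ0 x (hH b hb hx), (hn b hb).2, ?_⟩⟩
    have h1 : |(L (u b.1)).1 (G, ψ) - ψ.1 (u b.1)| ≤ c * (1 / 2) ^ n := hG3 b hb ψ
    have h2 : ψ.1 (u b.1) = 0 := hφ0 _ (hH b hb (hS b hb).2)
    rwa [h2, sub_zero] at h1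
  have hmono : StrictMono fun i => (a i).1 :=
    strictMono_nat_of_lt_succ fun i => (hab i (i + 1) i.lt_succ_self).1
  have hchain : IsVanishingChain fun i => (a i).2 :=
    ⟨monotone_nat_of_le_succ fun i => (hab i (i + 1) i.lt_succ_self).2.1,
      fun i => (hab i (i + 1) i.lt_succ_self).2.2.1⟩
  have hpow : ∀ i, c * (1 / 2 : ℝ) ^ (a i).1 ≤ c * (1 / 2) ^ i := fun i =>
    mul_le_mul_of_nonneg_left
      (pow_le_pow_of_le_one (by norm_num) (by norm_num) (hmono.id_le i)) hc0.le
  have hsum : HasSum (fun i => c * (1 / 2 : ℝ) ^ i) (c * 2) := hasSum_geometric_two.mul_left c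
  have hlow : ∀ k, d / 6 ≤ ChainFun.chainSumCLM hchain (L (u (a k).1)) := by
    intro k
    have hterm : ∀ i, (if i = k then d / 3 else 0) - c * (1 / 2 : ℝ) ^ i ≤
        (L (u (a k).1)).1 (a i).2 := by
      intro i
      rcases lt_trichotomy i k with h | rfl | h
      · rw [if_neg h.ne]
        linarith [(abs_le.1 (hab i k h).2.2.2.1).1, hpow i]
      · rw [if_pos rfl]
        linarith [(ha i).1, hpow i]
      · rw [if_neg h.ne']
        linarith [(abs_le.1 (hab k i h).2.2.2.2).1, hpow i]
    have h1 := hasSum_le hterm ((hasSum_ite_eq k (d / 3)).sub hsum)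
      ((L (u (a k).1)).summable_chain hchain).hasSum
    have h2 : d / 6 = d / 3 - c * 2 := by rw [hc]; ring
    exact h2.trans_le h1
  have hlim := (hu ((ChainFun.chainSumCLM hchain).comp L)).comp hmono.tendsto_atTop
  have := ge_of_tendsto hlim (Eventually.of_forall hlow)
  linarith

end Schur

end BLat

theorem theorem1p2 (E : Type*) [NormedAddCommGroup E] [NormedSpace ℝ E] [CompleteSpace E]
    (h : BLat.IsInftyProjective (BLat.FBL E)) : BLat.SchurProperty E := by
  obtain ⟨lam, -, hlam⟩ := h
  obtain ⟨S, -, hS, -⟩ := hlam (BLat.ChainFun E) (BLat.boundaryIdeal E) (BLat.boundaryHom E)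
    (BLat.isLatticeHom_boundaryHom E)
  intro u x hux
  -- The lift and the thresholded extension of δ_y lie in the same class, so they share the boundary
  -- δ_y; the lift is moreover linear in y.
  have hL : ∀ y, BLat.HasBoundary (S.comp BLat.evalFBL y).1 fun φ => φ y := fun y =>
    BLat.HasBoundary.of_mkQ_eq (hS (BLat.evalFBL y)).symm
      (BLat.hasBoundary_extension (BLat.evalFBL y))
  have hu : ∀ ψ : StrongDual ℝ E, Tendsto (fun n => ψ (u n - x)) atTop (𝓝 0) := by
    intro ψ
    have h1 := ((WeakBilin.eval_continuous (topDualPairing ℝ E).flip ψ).tendsto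
      (toWeakSpace ℝ E x)).comp hux
    have h2 : Tendsto (fun n => ψ (u n)) atTop (𝓝 (ψ x)) := h1
    simpa using h2.sub_const (ψ x)
  simpa using (BLat.tendsto_zero_of_hasBoundary _ hL hu).add_const x
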